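/- **Lemma 3.1.** Let $n\ge 2$ and $1\le q<p<q^*$, where $q^*=\frac{qn}{n-q}$ if $q<n$ and $q^*=\infty$ if $q\ge n$ (so $p<\infty$). For an open set $\Omega\subset\mathbb R^n$ and $1\le p<\infty$ let $W^{1,p}(\Omega)$ be the space of all real-valued $u\in L^p(\Omega)$ with a weak gradient $\nabla u\in L^p(\Omega;\mathbb R^n)$, with norm $\|u\|_{W^{1,p}(\Omega)}=\bigl(\int_\Omega |u|^p+|\nabla u|^p\,dx\bigr)^{1/p}$. A bounded domain (nonempty, open, connected set) $\Omega\subset\mathbb R^n$ is a $(W^{1,p},W^{1,q})$-extension domain if there are a map $E:W^{1,p}(\Omega)\to W^{1,q}(\mathbb R^n)$, not necessarily linear, and a constant $C>0$ such that $Eu|_\Omega=u$ and $\|Eu\|_{W^{1,q}(\mathbb R^n)}\le C\|u\|_{W^{1,p}(\Omega)}$ for all $u\in W^{1,p}(\Omega)$. Then there is $s\ge n$, depending only on $n$, $p$ and $q$, such that for every bounded $(W^{1,p},W^{1,q})$-extension domain $\Omega\subset\mathbb R^n$ there is $\delta>0$ with $$|B(x,r)\cap\Omega|\ \ge\ \delta\,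 r^s\qquad\text{for every } x\in\partial\Omega \text{ and every } 0<r\le \tfrac{\operatorname{diam}(\Omega)}{6}.$$ When $q<n$, one may take $s=\dfrac{1}{\frac1p-\frac1{q^*}}$. -/

import Mathlib

open MeasureTheory Set
open scoped ENNReal ContDiff

noncomputable section

/-- `g` is a weak (distributional) gradient of `u` on the open set `Ω ⊆ ℝⁿ`: both are locally
integrable on `Ω`, and `∫_Ω u ∂ᵢφ = -∫_Ω gᵢ φ` for every `φ ∈ C_c^∞(Ω)` and every `i`. -/
structure IsWeakGradient {n : ℕ} (Ω : Set (EuclideanSpace ℝ (Fin n)))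
    (u : EuclideanSpace ℝ (Fin n) → ℝ)
    (g : EuclideanSpace ℝ (Fin n) → EuclideanSpace ℝ (Fin n)) : Prop where
  locallyIntegrableOn : LocallyIntegrableOn u Ω volume
  locallyIntegrableOn_grad : LocallyIntegrableOn g Ω volume
  integral_eq : ∀ φ : EuclideanSpace ℝ (Fin n) → ℝ,
    ContDiff ℝ ∞ φ → HasCompactSupport φ → tsupport φ ⊆ Ω → ∀ i : Fin n,
      ∫ x in Ω, u x * fderiv ℝ φ x (EuclideanSpace.single i 1) = -∫ x in Ω, g x i * φ x

/-- A weak gradient is unique up to a null set, so `weakGrad` below does not depend on the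
choice made in it. -/
theorem IsWeakGradient.ae_eq {n : ℕ} {Ω : Set (EuclideanSpace ℝ (Fin n))} (hΩ : IsOpen Ω)
    {u u' : EuclideanSpace ℝ (Fin n) → ℝ}
    {g g' : EuclideanSpace ℝ (Fin n) → EuclideanSpace ℝ (Fin n)}
    (huu' : u =ᵐ[volume.restrict Ω] u')
    (h : IsWeakGradient Ω u g) (h' : IsWeakGradient Ω u' g') :
    g =ᵐ[volume.restrict Ω] g' := by
  have key : ∀ i : Fin n, ∀ᵐ x ∂volume, x ∈ Ω → g x i - g' x i = 0 := by
    intro i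
    have hg := h.locallyIntegrableOn_grad
    have hg' := h'.locallyIntegrableOn_grad
    have hc : ∀ {f : EuclideanSpace ℝ (Fin n) → EuclideanSpace ℝ (Fin n)},
        LocallyIntegrableOn f Ω volume → LocallyIntegrableOn (fun x => f x i) Ω volume := by
      intro f hf x hx
      obtain ⟨t, ht, hft⟩ := hf x hx
      exact ⟨t, ht, (EuclideanSpace.proj (𝕜 := ℝ) i).integrable_comp hft⟩
    refine hΩ.ae_eq_zero_of_integral_contDiff_smul_eq_zero ((hc hg).sub (hc hg')) ?_
    intro φ hφ hφc hφs
    have hint : ∀ {f : EuclideanSpace ℝ (Fin n) → EuclideanSpace ℝ (Fin n)},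
        LocallyIntegrableOn f Ω volume → Integrable (fun x => f x i * φ x) volume := by
      intro f hf
      have h1 := (hc hf).integrableOn_compact_subset hφs hφc
      have h2 : IntegrableOn (fun x => f x i * φ x) (tsupport φ) volume :=
        h1.mul_continuousOn hφ.continuous.continuousOn hφc
      refine (integrableOn_iff_integrable_of_support_subset ?_).1 h2
      intro x hx
      exact subset_tsupport φ (right_ne_zero_of_mul hx)
    have hsupp : ∀ f : EuclideanSpace ℝ (Fin n) → EuclideanSpace ℝ (Fin n),
        ∫ x in Ω, f x i * φ x = ∫ x, f x i * φ x := by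
      intro f
      refine setIntegral_eq_integral_of_forall_compl_eq_zero ?_
      intro x hx
      have : φ x = 0 := image_eq_zero_of_notMem_tsupport fun hh => hx (hφs hh)
      simp [this]
    have e1 := h.integral_eq φ hφ hφc hφs i
    have e2 := h'.integral_eq φ hφ hφc hφs i
    have e3 : ∫ x in Ω, u x * fderiv ℝ φ x (EuclideanSpace.single i 1)
        = ∫ x in Ω, u' x * fderiv ℝ φ x (EuclideanSpace.single i 1) := by
      refine integral_congr_ae ?_
      filter_upwards [huu'] with x hx
      rw [hx]
    rw [hsupp] at e1 e2
    have e4 : ∫ x, g x i * φ x = ∫ x, g' x i * φ x := by linarith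
    have : (fun x => φ x • (g x i - g' x i)) = fun x => g x i * φ x - g' x i * φ x := by
      funext x
      simp only [smul_eq_mul]
      ring
    calc ∫ x, φ x • (g x i - g' x i) = ∫ x, (g x i * φ x - g' x i * φ x) := by rw [this]
      _ = 0 := by rw [integral_sub (hint hg) (hint hg'), e4, sub_self]
  refine (ae_restrict_iff' hΩ.measurableSet).2 ?_
  filter_upwards [ae_all_iff.2 key] with x hx hxΩ
  ext i
  exact sub_eq_zero.1 (hx i hxΩ)

/-- The Sobolev space `W^{1,p}(Ω)`: the classes `u ∈ L^p(Ω)` that have a weak gradient in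
`L^p(Ω; ℝⁿ)`. -/
def SobolevSpace {n : ℕ} (p : ℝ) (Ω : Set (EuclideanSpace ℝ (Fin n))) :
    Set (Lp ℝ (ENNReal.ofReal p) (volume.restrict Ω)) :=
  {u | ∃ g : EuclideanSpace ℝ (Fin n) → EuclideanSpace ℝ (Fin n),
    MemLp g (ENNReal.ofReal p) (volume.restrict Ω) ∧ IsWeakGradient Ω u g}

/-- The weak gradient `∇u` of `u ∈ W^{1,p}(Ω)`. -/
def weakGrad {n : ℕ} {p : ℝ} {Ω : Set (EuclideanSpace ℝ (Fin n))} (u : SobolevSpace p Ω) :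
    EuclideanSpace ℝ (Fin n) → EuclideanSpace ℝ (Fin n) :=
  u.2.choose

/-- The Sobolev norm `(∫_Ω |u|^p + |∇u|^p)^{1/p}`. -/
def sobolevNorm {n : ℕ} {p : ℝ} {Ω : Set (EuclideanSpace ℝ (Fin n))} (u : SobolevSpace p Ω) : ℝ :=
  (∫ x in Ω, (|u.1 x| ^ p + ‖weakGrad u x‖ ^ p)) ^ (1 / p)

/-- `Ω` is a bounded `(W^{1,p}, W^{1,q})`-extension domain: a bounded, open, connected, nonempty
set with a bounded extension operator `E : W^{1,p}(Ω) → W^{1,q}(ℝⁿ)`, not required to be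
linear. -/
structure IsBoundedExtensionDomain {n : ℕ} (p q : ℝ) (Ω : Set (EuclideanSpace ℝ (Fin n))) :
    Prop where
  isOpen : IsOpen Ω
  isConnected : IsConnected Ω
  isBounded : Bornology.IsBounded Ω
  exists_extension : ∃ (E : SobolevSpace p Ω →
      SobolevSpace q (Set.univ : Set (EuclideanSpace ℝ (Fin n)))) (C : ℝ), 0 < C ∧
    ∀ u : SobolevSpace p Ω,
      (∀ᵐ x ∂volume.restrict Ω, (E u).1 x = u.1 x) ∧ sobolevNorm (E u) ≤ C * sobolevNorm u

/-- The Sobolev conjugate exponent: `q* = qn/(n-q)` if `q < n`, and `q* = ∞` if `q ≥ n`. -/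
def sobolevConjugate (n : ℕ) (q : ℝ) : EReal :=
  if q < n then ((q * n / (n - q) : ℝ) : EReal) else ⊤

end

/-!
Write `m ρ = |B(x, ρ) ∩ Ω|` for `x ∈ ∂Ω`. For `0 < ρ' < ρ ≤ diam Ω`, a Lipschitz cutoff `u` that
equals `1` on `B(x, ρ')` and vanishes off `B(x, ρ)` has
`‖u‖_{W^{1,p}(Ω)} ≲ (ρ - ρ')⁻¹ m(ρ)^{1/p}` (`exists_sobolevSpace_eq_one_on_ball`). Its extension
`Eu ∈ W^{1,q}(ℝⁿ)` equals `1` almost everywhere on `B(x, ρ') ∩ Ω`, so a local Sobolev inequality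
`‖Eu‖_{L^t(B)} ≲ ‖Eu‖_{W^{1,q}(ℝⁿ)}` on a ball `B ⊇ Ω` (`exists_eLpNorm_restrict_ball_le`) gives
`m(ρ')^{1/t} ≤ C (ρ - ρ')⁻¹ m(ρ)^{1/p}`
(`IsBoundedExtensionDomain.exists_rpow_volume_ball_inter_le`).

Since `p < t`, this is a De Giorgi iteration (`exists_rpow_le_of_iterative_bound`): with
`1/s = 1/p - 1/t`, if `m(r) < δ r^s` for a small `δ` depending only on `C`, then `m(r/2) = 0`, which
is impossible because `Ω` is open and `x` lies in its closure.

If `q < n` take `t = q*`. If `q ≥ n` take `t = 2p`, which is the Sobolev conjugate of some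
`q' ∈ [1, n)`, and use that `L^q` embeds into `L^{q'}` on bounded sets; this gives `s = 2p ≥ n`.

Mathlib has the Gagliardo–Nirenberg–Sobolev inequality for compactly supported `C¹` functions. The
version for Sobolev functions follows by mollifying, multiplying with a fixed cutoff, and applying
Fatou's lemma along the mollifications, which converge almost everywhere.
-/

/-! ### An iteration on scales -/

/-- De Giorgi iteration. The inequality is applied along the radii `r/2 + (r/2) 2⁻ʲ`, which decrease
to `r/2`; if `m r < δ r^s`, it propagates the bound `m ≤ δ (r 2⁻ʲ)^s` along them, so
`m (r/2) ≤ 0`. -/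
theorem exists_rpow_le_of_iterative_bound {p t s C : ℝ} (hp : 0 < p) (ht : 0 < t) (hs : 0 < s)
    (hst : 1 / p - 1 / t = 1 / s) (hC : 0 < C) :
    ∃ δ : ℝ, 0 < δ ∧ ∀ (m : ℝ → ℝ) (r : ℝ), 0 < r → Monotone m → (∀ ρ, 0 < ρ → 0 < m ρ) →
      (∀ ρ' ρ, 0 < ρ' → ρ' < ρ → ρ ≤ r →
        m ρ' ^ (1 / t) ≤ C / (ρ - ρ') * m ρ ^ (1 / p)) → δ * r ^ s ≤ m r := by
  -- `δ` is chosen so that the bound at step `j` yields exactly the bound at step `j + 1`.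
  have hb : 0 < (2 : ℝ) ^ (-(s / t)) / (4 * C) := by positivity
  obtain ⟨δ, hδ, hδs⟩ : ∃ δ : ℝ, 0 < δ ∧ δ ^ (1 / s) = (2 : ℝ) ^ (-(s / t)) / (4 * C) := by
    refine ⟨((2 : ℝ) ^ (-(s / t)) / (4 * C)) ^ s, by positivity, ?_⟩
    rw [← Real.rpow_mul hb.le, mul_one_div_cancel hs.ne', Real.rpow_one]
  refine ⟨δ, hδ, fun m r hr hm hpos h => ?_⟩
  by_contra! hlt
  have key : ∀ j : ℕ, m (r / 2 + r / 2 * (1 / 2) ^ j) ≤ δ * (r * (1 / 2) ^ j) ^ s := by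
    intro j
    induction j with
    | zero =>
      have e : r / 2 + r / 2 * (1 / 2 : ℝ) ^ 0 = r := by ring
      rw [e]
      simpa using hlt.le
    | succ j ih =>
      set a : ℝ := r * (1 / 2) ^ j with ha
      have ha0 : 0 < a := by positivity
      have har : a ≤ r := by
        have : (1 / 2 : ℝ) ^ j ≤ 1 := pow_le_one₀ (by norm_num) (by norm_num)
        nlinarith
      have e1 : r / 2 + r / 2 * (1 / 2 : ℝ) ^ (j + 1) = r / 2 + a / 4 := by
        rw [ha, pow_succ]; ring
      have e2 : r / 2 + r / 2 * (1 / 2 : ℝ) ^ j = r / 2 + a / 2 := by rw [ha]; ring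
      have e3 : r * (1 / 2 : ℝ) ^ (j + 1) = a / 2 := by rw [ha, pow_succ]; ring
      rw [e2] at ih
      rw [e1, e3]
      have h1 := h (r / 2 + a / 4) (r / 2 + a / 2) (by positivity) (by linarith) (by linarith)
      have h0 : 0 ≤ m (r / 2 + a / 4) := (hpos _ (by positivity)).le
      have h0' : 0 ≤ m (r / 2 + a / 2) := (hpos _ (by positivity)).le
      rw [← Real.rpow_le_rpow_iff h0 (by positivity) (by positivity : 0 < 1 / t)]
      refine h1.trans ?_
      have e4 : r / 2 + a / 2 - (r / 2 + a / 4) = a / 4 := by ring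
      rw [e4]
      calc C / (a / 4) * m (r / 2 + a / 2) ^ (1 / p)
          ≤ C / (a / 4) * (δ * a ^ s) ^ (1 / p) := by gcongr
        _ = (δ * (a / 2) ^ s) ^ (1 / t) := by
          have hp' : 1 / p = 1 / t + 1 / s := by linarith
          have h3 : (δ * a ^ s) ^ (1 / p) = δ ^ (1 / t) * δ ^ (1 / s) * (a ^ (s / t) * a) := by
            rw [Real.mul_rpow hδ.le (by positivity), ← Real.rpow_mul ha0.le, hp',
              Real.rpow_add hδ, mul_add, mul_one_div_cancel hs.ne', mul_one_div,
              Real.rpow_add ha0, Real.rpow_one]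
          have h4 : (δ * (a / 2) ^ s) ^ (1 / t) = δ ^ (1 / t) * (a ^ (s / t) * 2 ^ (-(s / t))) := by
            rw [Real.mul_rpow hδ.le (by positivity), ← Real.rpow_mul (by positivity), mul_one_div,
              Real.div_rpow ha0.le (by norm_num), Real.rpow_neg (by norm_num), div_eq_mul_inv (a ^ _)]
          rw [h3, h4, hδs]
          field_simp
  have hlim : Filter.Tendsto (fun j : ℕ => δ * (r * (1 / 2 : ℝ) ^ j) ^ s) Filter.atTop
      (nhds (δ * (r * 0) ^ s)) := by
    refine Filter.Tendsto.const_mul _ (Filter.Tendsto.rpow_const ?_ (Or.inr hs.le))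
    exact (tendsto_pow_atTop_nhds_zero_of_lt_one (by norm_num) (by norm_num)).const_mul _
  have hle : m (r / 2) ≤ δ * (r * 0) ^ s :=
    ge_of_tendsto' hlim fun j => (hm (le_add_of_nonneg_right (by positivity))).trans (key j)
  rw [mul_zero, Real.zero_rpow hs.ne', mul_zero] at hle
  exact absurd hle (not_le.2 (hpos _ (by positivity)))

/-! ### Mollification -/

/-- Young's inequality for convolution with a probability density. -/
theorem eLpNorm_convolution_le_of_lintegral_eq_one {n : ℕ} {φ v : EuclideanSpace ℝ (Fin n) → ℝ}
    (hφ : Measurable φ) (hφ1 : ∫⁻ y, ‖φ y‖ₑ = 1) (hv : AEStronglyMeasurable v volume)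
    {q : ℝ} (hq : 1 ≤ q) :
    eLpNorm (convolution φ v (ContinuousLinearMap.lsmul ℝ ℝ) volume) (ENNReal.ofReal q) volume
      ≤ eLpNorm v (ENNReal.ofReal q) volume := by
  wlog hvm : StronglyMeasurable v generalizing v
  · have := this hv.stronglyMeasurable_mk.aestronglyMeasurable hv.stronglyMeasurable_mk
    rwa [← eLpNorm_congr_ae hv.ae_eq_mk,
      ← convolution_congr _ Filter.EventuallyEq.rfl hv.ae_eq_mk] at this
  have hq0 : 0 < q := by linarith
  have hqe : ENNReal.ofReal q ≠ 0 := by simpa using hq0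
  have hqr : (ENNReal.ofReal q).toReal = q := ENNReal.toReal_ofReal hq0.le
  -- Jensen's inequality for the probability measure `ν = |φ| dy`, and Tonelli's theorem.
  set ν : Measure (EuclideanSpace ℝ (Fin n)) := volume.withDensity (fun y => ‖φ y‖ₑ) with hν
  have hνp : IsProbabilityMeasure ν := ⟨by simp [hν, hφ1]⟩
  rw [eLpNorm_eq_lintegral_rpow_enorm_toReal hqe ENNReal.ofReal_ne_top,
    eLpNorm_eq_lintegral_rpow_enorm_toReal hqe ENNReal.ofReal_ne_top, hqr]
  refine ENNReal.rpow_le_rpow ?_ (by positivity)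
  have hm2 : Measurable fun z : EuclideanSpace ℝ (Fin n) × EuclideanSpace ℝ (Fin n) =>
      ‖v (z.1 - z.2)‖ₑ ^ q :=
    ((hvm.measurable.comp (measurable_fst.sub measurable_snd)).enorm).pow_const q
  have hpt : ∀ x, ‖convolution φ v (ContinuousLinearMap.lsmul ℝ ℝ) volume x‖ₑ ^ q
      ≤ ∫⁻ y, ‖v (x - y)‖ₑ ^ q ∂ν := by
    intro x
    have hmx : Measurable fun y => v (x - y) :=
      hvm.measurable.comp (measurable_const.sub measurable_id)
    have h1 : ‖convolution φ v (ContinuousLinearMap.lsmul ℝ ℝ) volume x‖ₑ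
        ≤ ∫⁻ y, ‖v (x - y)‖ₑ ∂ν := by
      rw [hν, lintegral_withDensity_eq_lintegral_mul _ hφ.enorm hmx.enorm]
      refine (enorm_integral_le_lintegral_enorm _).trans (le_of_eq ?_)
      refine lintegral_congr fun y => ?_
      simp [enorm_mul]
    have h2 := eLpNorm_le_eLpNorm_of_exponent_le (μ := ν) (p := 1) (q := ENNReal.ofReal q)
      (by simpa using hq) (f := fun y => v (x - y)) hmx.aestronglyMeasurable
    rw [eLpNorm_one_eq_lintegral_enorm,
      eLpNorm_eq_lintegral_rpow_enorm_toReal hqe ENNReal.ofReal_ne_top, hqr] at h2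
    have h3 := ENNReal.rpow_le_rpow (h1.trans h2) hq0.le
    rwa [← ENNReal.rpow_mul, one_div_mul_cancel hq0.ne', ENNReal.rpow_one] at h3
  calc ∫⁻ x, ‖convolution φ v (ContinuousLinearMap.lsmul ℝ ℝ) volume x‖ₑ ^ q
      ≤ ∫⁻ x, ∫⁻ y, ‖v (x - y)‖ₑ ^ q ∂ν := lintegral_mono hpt
    _ = ∫⁻ y, (∫⁻ x, ‖v (x - y)‖ₑ ^ q) ∂ν := lintegral_lintegral_swap hm2.aemeasurable
    _ = ∫⁻ y, (∫⁻ x, ‖v x‖ₑ ^ q) ∂ν := by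
      refine lintegral_congr fun y => ?_
      exact lintegral_sub_right_eq_self (fun x => ‖v x‖ₑ ^ q) y
    _ = ∫⁻ x, ‖v x‖ₑ ^ q := by simp

/-- Mollification commutes with weak differentiation: `∂ᵢ(φ ⋆ v) = φ ⋆ gᵢ`, by testing the weak
gradient against `y ↦ φ (x - y)`. -/
theorem IsWeakGradient.fderiv_convolution_single {n : ℕ} {v : EuclideanSpace ℝ (Fin n) → ℝ}
    {g : EuclideanSpace ℝ (Fin n) → EuclideanSpace ℝ (Fin n)} (h : IsWeakGradient univ v g)
    {φ : EuclideanSpace ℝ (Fin n) → ℝ} (hφ : ContDiff ℝ ∞ φ) (hφc : HasCompactSupport φ)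
    (x : EuclideanSpace ℝ (Fin n)) (i : Fin n) :
    fderiv ℝ (convolution φ v (ContinuousLinearMap.lsmul ℝ ℝ) volume) x
        (EuclideanSpace.single i 1) =
      convolution φ (fun y => g y i) (ContinuousLinearMap.lsmul ℝ ℝ) volume x := by
  have hv : LocallyIntegrable v volume := locallyIntegrableOn_univ.1 h.locallyIntegrableOn
  have hd := hφc.hasFDerivAt_convolution_left (ContinuousLinearMap.lsmul ℝ ℝ)
    (hφ.of_le (by norm_cast)) hv x
  have hex : ConvolutionExistsAt (fderiv ℝ φ) v x
      ((ContinuousLinearMap.lsmul ℝ ℝ).precompL (EuclideanSpace ℝ (Fin n))) volume :=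
    (hφc.fderiv ℝ).convolutionExists_left _ (hφ.continuous_fderiv (by simp)) hv x
  rw [hd.fderiv, convolution_eq_swap, ContinuousLinearMap.integral_apply, convolution_eq_swap]
  swap
  · exact hex.integrable_swap
  have hψ : ContDiff ℝ ∞ fun y => φ (x - y) := hφ.comp (contDiff_const.sub contDiff_id)
  have hψc : HasCompactSupport fun y => φ (x - y) :=
    hφc.comp_homeomorph (Homeomorph.subLeft x)
  have := h.integral_eq _ hψ hψc (subset_univ _) i
  simp only [Measure.restrict_univ] at this
  have hfd : ∀ y, fderiv ℝ (fun y => φ (x - y)) y (EuclideanSpace.single i 1)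
      = - fderiv ℝ φ (x - y) (EuclideanSpace.single i 1) := by
    intro y
    have h1 : HasFDerivAt φ (fderiv ℝ φ (x - y)) (x - y) :=
      (hφ.differentiable (by simp) _).hasFDerivAt
    have h2 := h1.comp y ((hasFDerivAt_id y).const_sub x)
    have h3 : HasFDerivAt (fun y => φ (x - y)) _ y := h2
    rw [h3.fderiv]
    simp
  simp only [hfd, mul_neg, integral_neg, neg_inj] at this
  simp only [ContinuousLinearMap.precompL_apply, ContinuousLinearMap.lsmul_apply, smul_eq_mul]
  simpa [mul_comm] using this

/-! ### A local Sobolev inequality -/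

/-- Local Sobolev inequality for `C¹` functions. The full `W^{1,q}` norm on the right allows to
reduce to compact support by multiplying with a fixed cutoff; on its support, Hölder's inequality
passes from the exponent `q' < n` of the Gagliardo–Nirenberg–Sobolev inequality to `q`. -/
theorem exists_eLpNorm_restrict_ball_le_of_contDiff {n : ℕ} {q' q t : ℝ} (hq' : 1 ≤ q')
    (hq'n : q' < n) (hqq : q' ≤ q) (ht : 0 < t) (hpq : 1 / q' - 1 / n ≤ 1 / t) {R : ℝ}
    (hR : 0 < R) :
    ∃ C : NNReal, ∀ w : EuclideanSpace ℝ (Fin n) → ℝ, ContDiff ℝ 1 w →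
      eLpNorm w (ENNReal.ofReal t) (volume.restrict (Metric.ball 0 R)) ≤
        C * (eLpNorm w (ENNReal.ofReal q) volume
          + eLpNorm (fderiv ℝ w) (ENNReal.ofReal q) volume) := by
  have hq0 : 0 < q := by linarith
  have hq'0 : 0 < q' := by linarith
  let η : ContDiffBump (0 : EuclideanSpace ℝ (Fin n)) := ⟨R, R + 1, hR, by linarith⟩
  set S : Set (EuclideanSpace ℝ (Fin n)) := Metric.closedBall 0 (R + 1)
  have hηd : ContDiff ℝ 1 η := η.contDiff
  have hηS : tsupport η = S := η.tsupport_eq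
  obtain ⟨K, hK⟩ := (η.hasCompactSupport.fderiv ℝ).exists_bound_of_continuous
    (hηd.continuous_fderiv one_ne_zero)
  set C₀ : NNReal := eLpNormLESNormFDerivOfLeConst ℝ
    (volume : Measure (EuclideanSpace ℝ (Fin n))) S q'.toNNReal t.toNNReal
  set M : ℝ≥0∞ := volume S ^ (1 / (ENNReal.ofReal q').toReal - 1 / (ENNReal.ofReal q).toReal)
  have hMtop : M ≠ ⊤ := by
    refine ENNReal.rpow_ne_top_of_nonneg ?_ measure_closedBall_lt_top.ne
    rw [ENNReal.toReal_ofReal hq0.le, ENNReal.toReal_ofReal hq'0.le, sub_nonneg]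
    exact one_div_le_one_div_of_le hq'0 hqq
  refine ⟨C₀ * M.toNNReal * (K.toNNReal + 1), fun w hw => ?_⟩
  set u : EuclideanSpace ℝ (Fin n) → ℝ := fun x => η x * w x with hu
  have hud : ContDiff ℝ 1 u := hηd.mul hw
  have husub : tsupport u ⊆ S := hηS ▸ tsupport_mul_subset_left
  have h1 : eLpNorm w (ENNReal.ofReal t) (volume.restrict (Metric.ball 0 R)) ≤
      eLpNorm u (ENNReal.ofReal t) volume := by
    refine le_trans (le_of_eq (eLpNorm_congr_ae ?_)) (eLpNorm_mono_measure u Measure.restrict_le_self)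
    refine (ae_restrict_iff' measurableSet_ball).2 (Filter.Eventually.of_forall fun x hx => ?_)
    have : η x = 1 := η.one_of_mem_closedBall (Metric.ball_subset_closedBall hx)
    simp [hu, this]
  have h2 : eLpNorm u (ENNReal.ofReal t) volume ≤
      C₀ * eLpNorm (fderiv ℝ u) (ENNReal.ofReal q') volume := by
    refine eLpNorm_le_eLpNorm_fderiv_of_le volume hud ((subset_tsupport u).trans husub)
      (p := q'.toNNReal) (q := t.toNNReal) ?_ ?_ ?_ Metric.isBounded_closedBall
    · simpa using hq'
    · rw [finrank_euclideanSpace_fin, Real.toNNReal_lt_iff_lt_coe hq'0.le]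
      simpa using hq'n
    · rw [finrank_euclideanSpace_fin, NNReal.coe_inv, Real.coe_toNNReal _ hq'0.le,
        Real.coe_toNNReal _ ht.le]
      simpa using hpq
  have h3 : eLpNorm (fderiv ℝ u) (ENNReal.ofReal q') volume ≤
      eLpNorm (fderiv ℝ u) (ENNReal.ofReal q) volume * M := by
    have hsupp : Function.support (fderiv ℝ u) ⊆ S :=
      ((subset_tsupport _).trans (tsupport_fderiv_subset ℝ)).trans husub
    have hres : eLpNorm (fderiv ℝ u) (ENNReal.ofReal q') (volume.restrict S) =
        eLpNorm (fderiv ℝ u) (ENNReal.ofReal q') volume :=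
      eLpNorm_restrict_eq_of_support_subset (f := fderiv ℝ u) (by exact hsupp)
    rw [← hres]
    refine (eLpNorm_le_eLpNorm_mul_rpow_measure_univ (ENNReal.ofReal_le_ofReal hqq)
      (hud.continuous_fderiv one_ne_zero).aestronglyMeasurable).trans ?_
    rw [Measure.restrict_apply_univ]
    gcongr
    exact Measure.restrict_le_self
  have h4 : eLpNorm (fderiv ℝ u) (ENNReal.ofReal q) volume ≤
      eLpNorm (fderiv ℝ w) (ENNReal.ofReal q) volume
        + ENNReal.ofReal K * eLpNorm w (ENNReal.ofReal q) volume := by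
    have hfd : fderiv ℝ u = (fun x => η x • fderiv ℝ w x) + fun x => w x • fderiv ℝ η x := by
      funext x
      exact fderiv_fun_mul (hηd.differentiable one_ne_zero x) (hw.differentiable one_ne_zero x)
    have hq1 : 1 ≤ ENNReal.ofReal q := by simpa using hq'.trans hqq
    rw [hfd]
    refine (eLpNorm_add_le
      (hηd.continuous.smul (hw.continuous_fderiv one_ne_zero)).aestronglyMeasurable
      (hw.continuous.smul (hηd.continuous_fderiv one_ne_zero)).aestronglyMeasurable hq1).trans ?_
    refine add_le_add (eLpNorm_mono fun x => ?_)
      (eLpNorm_le_mul_eLpNorm_of_ae_le_mul (Filter.Eventually.of_forall fun x => ?_) _)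
    · rw [Pi.smul_apply', norm_smul, Real.norm_of_nonneg η.nonneg]
      exact mul_le_of_le_one_left (norm_nonneg _) η.le_one
    · rw [Pi.smul_apply', norm_smul, mul_comm]
      exact mul_le_mul_of_nonneg_right (hK x) (norm_nonneg _)
  set A := eLpNorm w (ENNReal.ofReal q) volume
  set B := eLpNorm (fderiv ℝ w) (ENNReal.ofReal q) volume
  calc eLpNorm w (ENNReal.ofReal t) (volume.restrict (Metric.ball 0 R))
      ≤ C₀ * ((B + ENNReal.ofReal K * A) * M) :=
        h1.trans (h2.trans (mul_le_mul_right (h3.trans (mul_le_mul_left h4 _)) _))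
    _ ≤ C₀ * (((ENNReal.ofReal K + 1) * (A + B)) * M) := by
        gcongr
        calc B + ENNReal.ofReal K * A ≤ (B + ENNReal.ofReal K * A) + (A + ENNReal.ofReal K * B) :=
              le_self_add
          _ = _ := by ring
    _ = _ := by
        rw [ENNReal.coe_mul, ENNReal.coe_mul, ENNReal.coe_toNNReal hMtop, ENNReal.coe_add,
          ENNReal.coe_one]
        change _ = C₀ * M * (ENNReal.ofReal K + 1) * (A + B)
        ring

theorem norm_le_sum_norm_apply_single {n : ℕ} (L : EuclideanSpace ℝ (Fin n) →L[ℝ] ℝ) :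
    ‖L‖ ≤ ∑ i, ‖L (EuclideanSpace.single i 1)‖ := by
  refine L.opNorm_le_bound (by positivity) fun y => ?_
  have hy : y = ∑ i, y i • EuclideanSpace.single i (1 : ℝ) := by
    simpa using ((EuclideanSpace.basisFun (Fin n) ℝ).sum_repr y).symm
  conv_lhs => rw [hy]
  rw [map_sum, Finset.sum_mul]
  refine (norm_sum_le _ _).trans (Finset.sum_le_sum fun i _ => ?_)
  rw [map_smul, norm_smul, mul_comm]
  exact mul_le_mul_of_nonneg_left (PiLp.norm_apply_le y i) (norm_nonneg _)

theorem IsWeakGradient.eLpNorm_fderiv_convolution_le {n : ℕ} {q : ℝ} (hq : 1 ≤ q)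
    {v : EuclideanSpace ℝ (Fin n) → ℝ}
    {g : EuclideanSpace ℝ (Fin n) → EuclideanSpace ℝ (Fin n)} (h : IsWeakGradient univ v g)
    {φ : EuclideanSpace ℝ (Fin n) → ℝ} (hφ : ContDiff ℝ ∞ φ) (hφc : HasCompactSupport φ)
    (hφ1 : ∫⁻ y, ‖φ y‖ₑ = 1) :
    eLpNorm (fderiv ℝ (convolution φ v (ContinuousLinearMap.lsmul ℝ ℝ) volume))
      (ENNReal.ofReal q) volume ≤ n * eLpNorm g (ENNReal.ofReal q) volume := by
  have hv : LocallyIntegrable v volume := locallyIntegrableOn_univ.1 h.locallyIntegrableOn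
  have hgl : LocallyIntegrable g volume := locallyIntegrableOn_univ.1 h.locallyIntegrableOn_grad
  have hgi : ∀ i, LocallyIntegrable (fun y => g y i) volume := fun i x => by
    obtain ⟨s, hs, hgs⟩ := hgl x
    exact ⟨s, hs, (EuclideanSpace.proj (𝕜 := ℝ) i).integrable_comp hgs⟩
  set c : Fin n → EuclideanSpace ℝ (Fin n) → ℝ := fun i =>
    convolution φ (fun y => g y i) (ContinuousLinearMap.lsmul ℝ ℝ) volume
  have hcm : ∀ i, AEStronglyMeasurable (c i) volume := fun i =>
    (hφc.contDiff_convolution_left (n := 0) (ContinuousLinearMap.lsmul ℝ ℝ)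
      (hφ.of_le (by simp)) (hgi i)).continuous.aestronglyMeasurable
  calc eLpNorm (fderiv ℝ (convolution φ v (ContinuousLinearMap.lsmul ℝ ℝ) volume))
        (ENNReal.ofReal q) volume
      ≤ eLpNorm (∑ i, fun x => ‖c i x‖) (ENNReal.ofReal q) volume := by
        refine eLpNorm_mono_real fun x => ?_
        refine (norm_le_sum_norm_apply_single _).trans (le_of_eq ?_)
        rw [Finset.sum_apply]
        exact Finset.sum_congr rfl fun i _ => by rw [h.fderiv_convolution_single hφ hφc]
    _ ≤ ∑ i, eLpNorm (fun x => ‖c i x‖) (ENNReal.ofReal q) volume :=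
        eLpNorm_sum_le (fun i _ => (hcm i).norm) (by simpa using hq)
    _ ≤ ∑ _i : Fin n, eLpNorm g (ENNReal.ofReal q) volume := by
        refine Finset.sum_le_sum fun i _ => ?_
        rw [eLpNorm_norm]
        refine (eLpNorm_convolution_le_of_lintegral_eq_one hφ.continuous.measurable hφ1
          (hgi i).aestronglyMeasurable hq).trans (eLpNorm_mono fun x => PiLp.norm_apply_le _ _)
    _ = n * eLpNorm g (ENNReal.ofReal q) volume := by simp

/-- Local Sobolev inequality for weakly differentiable functions on `ℝⁿ`. -/
theorem exists_eLpNorm_restrict_ball_le {n : ℕ} {q' q t : ℝ} (hq' : 1 ≤ q')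
    (hq'n : q' < n) (hqq : q' ≤ q) (ht : 0 < t) (hpq : 1 / q' - 1 / n ≤ 1 / t) {R : ℝ}
    (hR : 0 < R) :
    ∃ C : NNReal, ∀ (v : EuclideanSpace ℝ (Fin n) → ℝ)
      (g : EuclideanSpace ℝ (Fin n) → EuclideanSpace ℝ (Fin n)), IsWeakGradient univ v g →
      eLpNorm v (ENNReal.ofReal t) (volume.restrict (Metric.ball 0 R)) ≤
        C * (eLpNorm v (ENNReal.ofReal q) volume + eLpNorm g (ENNReal.ofReal q) volume) := by
  obtain ⟨C, hC⟩ := exists_eLpNorm_restrict_ball_le_of_contDiff hq' hq'n hqq ht hpq hR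
  refine ⟨C * (n + 1), fun v g h => ?_⟩
  have hv : LocallyIntegrable v volume := locallyIntegrableOn_univ.1 h.locallyIntegrableOn
  have hq1 : 1 ≤ q := hq'.trans hqq
  let φ : ℕ → ContDiffBump (0 : EuclideanSpace ℝ (Fin n)) := fun k =>
    ⟨1 / ((k : ℝ) + 1), 2 * (1 / ((k : ℝ) + 1)), by positivity, by
      have : 0 < 1 / ((k : ℝ) + 1) := by positivity
      linarith⟩
  have hφlim : Filter.Tendsto (fun k => (φ k).rOut) Filter.atTop (nhds 0) := by
    have := (tendsto_one_div_add_atTop_nhds_zero_nat (𝕜 := ℝ)).const_mul 2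
    rwa [mul_zero] at this
  have hφ1 : ∀ k, ∫⁻ y, ‖(φ k).normed volume y‖ₑ = 1 := fun k => by
    rw [← ofReal_integral_norm_eq_lintegral_enorm (φ k).integrable_normed]
    simp only [Real.norm_of_nonneg ((φ k).nonneg_normed _), (φ k).integral_normed,
      ENNReal.ofReal_one]
  set w : ℕ → EuclideanSpace ℝ (Fin n) → ℝ := fun k =>
    convolution ((φ k).normed volume) v (ContinuousLinearMap.lsmul ℝ ℝ) volume
  have hwd : ∀ k, ContDiff ℝ 1 (w k) := fun k =>
    (φ k).hasCompactSupport_normed.contDiff_convolution_left (n := 1) _ (φ k).contDiff_normed hv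
  have hae : ∀ᵐ x ∂(volume : Measure (EuclideanSpace ℝ (Fin n))),
      Filter.Tendsto (fun k => w k x) Filter.atTop (nhds (v x)) :=
    ContDiffBump.ae_convolution_tendsto_right_of_locallyIntegrable (K := 2) hφlim
      (Filter.Eventually.of_forall fun k => le_rfl) hv
  refine (Lp.eLpNorm_lim_le_liminf_eLpNorm
    (fun k => (hwd k).continuous.aestronglyMeasurable) v (ae_restrict_of_ae hae)).trans ?_
  refine Filter.liminf_le_of_frequently_le' (Filter.Frequently.of_forall fun k => ?_)
  refine (hC _ (hwd k)).trans ?_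
  rw [ENNReal.coe_mul, mul_assoc]
  refine mul_le_mul_right ?_ _
  have h1 := eLpNorm_convolution_le_of_lintegral_eq_one (φ k).continuous_normed.measurable
    (hφ1 k) hv.aestronglyMeasurable hq1
  have h2 := h.eLpNorm_fderiv_convolution_le hq1
    (φ k).contDiff_normed (φ k).hasCompactSupport_normed (hφ1 k)
  refine (add_le_add h1 h2).trans ?_
  rw [ENNReal.coe_add, ENNReal.coe_natCast, ENNReal.coe_one]
  calc eLpNorm v (ENNReal.ofReal q) volume + n * eLpNorm g (ENNReal.ofReal q) volume
      ≤ (eLpNorm v (ENNReal.ofReal q) volume + n * eLpNorm g (ENNReal.ofReal q) volume)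
        + (n * eLpNorm v (ENNReal.ofReal q) volume + eLpNorm g (ENNReal.ofReal q) volume) :=
        le_self_add
    _ = _ := by ring

/-! ### The Sobolev norm -/

section SobolevNorm

variable {n : ℕ} {p : ℝ} {Ω : Set (EuclideanSpace ℝ (Fin n))}

theorem isWeakGradient_weakGrad (u : SobolevSpace p Ω) : IsWeakGradient Ω u.1 (weakGrad u) :=
  u.2.choose_spec.2

theorem memLp_weakGrad (u : SobolevSpace p Ω) :
    MemLp (weakGrad u) (ENNReal.ofReal p) (volume.restrict Ω) :=
  u.2.choose_spec.1

/-- The Sobolev norm as a lower Lebesgue integral; integrability of the two summands, needed for the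
real integral not to be a junk value, comes from membership in `SobolevSpace p Ω`. -/
theorem ofReal_sobolevNorm (hp : 0 < p) (u : SobolevSpace p Ω) :
    ENNReal.ofReal (sobolevNorm u) =
      (∫⁻ x in Ω, (‖u.1 x‖ₑ ^ p + ‖weakGrad u x‖ₑ ^ p)) ^ (1 / p) := by
  have hpe : ENNReal.ofReal p ≠ 0 := by simpa using hp
  have hpr : (ENNReal.ofReal p).toReal = p := ENNReal.toReal_ofReal hp.le
  have h1 := (Lp.memLp u.1).integrable_norm_rpow hpe ENNReal.ofReal_ne_top
  have h2 := (memLp_weakGrad u).integrable_norm_rpow hpe ENNReal.ofReal_ne_top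
  rw [hpr] at h1 h2
  have h12 : Integrable (fun x => |u.1 x| ^ p + ‖weakGrad u x‖ ^ p) (volume.restrict Ω) :=
    h1.add h2
  rw [sobolevNorm, ← ENNReal.ofReal_rpow_of_nonneg (integral_nonneg fun x => by positivity)
    (by positivity), ofReal_integral_eq_lintegral_ofReal h12
      (Filter.Eventually.of_forall fun x => by positivity)]
  congr 1
  refine lintegral_congr fun x => ?_
  rw [ENNReal.ofReal_add (by positivity) (by positivity),
    ← ENNReal.ofReal_rpow_of_nonneg (abs_nonneg _) hp.le,
    ← ENNReal.ofReal_rpow_of_nonneg (norm_nonneg _) hp.le, ofReal_norm,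
    ← Real.norm_eq_abs, ofReal_norm]

theorem eLpNorm_le_sobolevNorm (hp : 0 < p) (u : SobolevSpace p Ω) :
    eLpNorm u.1 (ENNReal.ofReal p) (volume.restrict Ω) ≤ ENNReal.ofReal (sobolevNorm u) := by
  rw [ofReal_sobolevNorm hp, eLpNorm_eq_lintegral_rpow_enorm_toReal (by simpa using hp)
    ENNReal.ofReal_ne_top, ENNReal.toReal_ofReal hp.le]
  exact ENNReal.rpow_le_rpow (lintegral_mono fun x => le_self_add) (by positivity)

theorem eLpNorm_weakGrad_le_sobolevNorm (hp : 0 < p) (u : SobolevSpace p Ω) :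
    eLpNorm (weakGrad u) (ENNReal.ofReal p) (volume.restrict Ω) ≤
      ENNReal.ofReal (sobolevNorm u) := by
  rw [ofReal_sobolevNorm hp, eLpNorm_eq_lintegral_rpow_enorm_toReal (by simpa using hp)
    ENNReal.ofReal_ne_top, ENNReal.toReal_ofReal hp.le]
  exact ENNReal.rpow_le_rpow (lintegral_mono fun x => le_add_self) (by positivity)

end SobolevNorm

/-! ### Lipschitz functions and cutoffs -/

theorem IsWeakGradient.congr_left {n : ℕ} {Ω : Set (EuclideanSpace ℝ (Fin n))}
    {u u' : EuclideanSpace ℝ (Fin n) → ℝ}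
    {g : EuclideanSpace ℝ (Fin n) → EuclideanSpace ℝ (Fin n)} (h : IsWeakGradient Ω u g)
    (huu' : u =ᵐ[volume.restrict Ω] u') : IsWeakGradient Ω u' g := by
  refine ⟨fun x hx => ?_, h.locallyIntegrableOn_grad, fun φ hφ hφc hφs i => ?_⟩
  · obtain ⟨s, hs, hus⟩ := h.locallyIntegrableOn x hx
    refine ⟨s ∩ Ω, Filter.inter_mem hs self_mem_nhdsWithin, ?_⟩
    exact (hus.mono_set inter_subset_left).congr_fun_ae
      (ae_mono (Measure.restrict_mono inter_subset_right le_rfl) huu')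
  · rw [← h.integral_eq φ hφ hφc hφs i]
    refine integral_congr_ae ?_
    filter_upwards [huu'] with x hx
    rw [hx]

theorem gradient_apply_eq_fderiv_single {n : ℕ} (f : EuclideanSpace ℝ (Fin n) → ℝ)
    (x : EuclideanSpace ℝ (Fin n)) (i : Fin n) :
    gradient f x i = fderiv ℝ f x (EuclideanSpace.single i 1) := by
  have h : inner ℝ (gradient f x) (EuclideanSpace.single i (1 : ℝ)) =
      fderiv ℝ f x (EuclideanSpace.single i 1) := by
    rw [gradient, InnerProductSpace.toDual_symm_apply]
  rw [← h, EuclideanSpace.inner_single_right]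
  simp

theorem measurable_gradient {n : ℕ} (f : EuclideanSpace ℝ (Fin n) → ℝ) :
    Measurable (gradient f) :=
  (InnerProductSpace.toDual ℝ (EuclideanSpace ℝ (Fin n))).symm.continuous.measurable.comp
    (measurable_fderiv ℝ f)

theorem norm_gradient_le_of_lipschitzWith {n : ℕ} {f : EuclideanSpace ℝ (Fin n) → ℝ} {K : NNReal}
    (hf : LipschitzWith K f) (x : EuclideanSpace ℝ (Fin n)) : ‖gradient f x‖ ≤ K := by
  rw [gradient, LinearIsometryEquiv.norm_map]
  exact norm_fderiv_le_of_lipschitz ℝ hf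

/-- The pointwise gradient of a Lipschitz function, which exists almost everywhere by Rademacher's
theorem, is its weak gradient. -/
theorem LipschitzWith.isWeakGradient_gradient {n : ℕ} {f : EuclideanSpace ℝ (Fin n) → ℝ}
    {K : NNReal} (hf : LipschitzWith K f) (Ω : Set (EuclideanSpace ℝ (Fin n))) :
    IsWeakGradient Ω f (gradient f) := by
  refine ⟨(hf.continuous.locallyIntegrable).locallyIntegrableOn _, ?_, fun φ hφ hφc hφs i => ?_⟩
  · refine LocallyIntegrable.locallyIntegrableOn (fun x => ?_) _
    refine ⟨Metric.ball x 1, Metric.ball_mem_nhds _ one_pos, ?_⟩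
    exact Measure.integrableOn_of_bounded (M := K) measure_ball_lt_top.ne
      (measurable_gradient f).aestronglyMeasurable
      (Filter.Eventually.of_forall fun y => norm_gradient_le_of_lipschitzWith hf y)
  · have hφ0 : ∀ x, x ∉ Ω → φ x = 0 := fun x hx =>
      image_eq_zero_of_notMem_tsupport fun h => hx (hφs h)
    have hφ0' : ∀ x, x ∉ Ω → fderiv ℝ φ x = 0 := fun x hx =>
      image_eq_zero_of_notMem_tsupport fun h => hx (hφs (tsupport_fderiv_subset ℝ h))
    rw [setIntegral_eq_integral_of_forall_compl_eq_zero fun x hx => by simp [hφ0' x hx],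
      setIntegral_eq_integral_of_forall_compl_eq_zero fun x hx => by simp [hφ0 x hx]]
    obtain ⟨D, hD⟩ := ContDiff.lipschitzWith_of_hasCompactSupport hφc hφ (by simp)
    have key := hf.integral_lineDeriv_mul_eq (μ := volume) hD hφc (EuclideanSpace.single i 1)
    have h1 : ∫ x, lineDeriv ℝ f x (EuclideanSpace.single i 1) * φ x =
        ∫ x, gradient f x i * φ x := by
      refine integral_congr_ae ?_
      filter_upwards [hf.ae_differentiableAt] with x hx
      rw [hx.lineDeriv_eq_fderiv, gradient_apply_eq_fderiv_single]
    have h2 : ∫ x, lineDeriv ℝ φ x (-EuclideanSpace.single i 1) * f x =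
        -∫ x, f x * fderiv ℝ φ x (EuclideanSpace.single i 1) := by
      rw [← integral_neg]
      refine integral_congr_ae (Filter.Eventually.of_forall fun x => ?_)
      have : DifferentiableAt ℝ φ x := hφ.differentiable (by simp) x
      simp only [this.lineDeriv_eq_fderiv, map_neg]
      ring
    rw [← h1, key, h2, neg_neg]

/-- The test function: a cutoff between two concentric balls, which is Lipschitz with constant
`1 / (ρ - ρ')`. -/
theorem exists_sobolevSpace_eq_one_on_ball {n : ℕ} {p : ℝ} (hp : 1 ≤ p)
    {Ω : Set (EuclideanSpace ℝ (Fin n))} (hΩ : IsOpen Ω) (hΩb : Bornology.IsBounded Ω)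
    (x : EuclideanSpace ℝ (Fin n)) {ρ' ρ : ℝ} (hρ' : 0 < ρ') (hρ : ρ' < ρ) :
    ∃ u : SobolevSpace p Ω,
      (∀ᵐ y ∂volume.restrict Ω, y ∈ Metric.ball x ρ' → u.1 y = 1) ∧
      ENNReal.ofReal (sobolevNorm u) ≤
        ENNReal.ofReal (1 + 1 / (ρ - ρ')) * volume (Metric.ball x ρ ∩ Ω) ^ (1 / p) := by
  have hp0 : 0 < p := by linarith
  have hδ : 0 < ρ - ρ' := by linarith
  have : IsFiniteMeasure (volume.restrict Ω) :=
    ⟨by rw [Measure.restrict_apply_univ]; exact hΩb.measure_lt_top⟩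
  set f : EuclideanSpace ℝ (Fin n) → ℝ := fun y =>
    (thickenedIndicator hδ (Metric.ball x ρ') y : ℝ)
  have hf0 : ∀ y, 0 ≤ f y := fun y => NNReal.coe_nonneg _
  have hf1 : ∀ y, f y ≤ 1 := fun y => by
    exact_mod_cast thickenedIndicator_le_one hδ (Metric.ball x ρ') y
  have hfin : ∀ y ∈ Metric.ball x ρ', f y = 1 := fun y hy => by
    exact NNReal.coe_eq_one.2 (thickenedIndicator_one hδ (Metric.ball x ρ') hy)
  have hfout : ∀ y, y ∉ Metric.ball x ρ → f y = 0 := fun y hy => by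
    have : y ∉ Metric.thickening (ρ - ρ') (Metric.ball x ρ') := by
      rw [thickening_ball hδ hρ']
      simpa using hy
    exact NNReal.coe_eq_zero.2 (thickenedIndicator_zero hδ (Metric.ball x ρ') this)
  have hfL : LipschitzWith (ρ - ρ').toNNReal⁻¹ f :=
    lipschitzWith_thickenedIndicator hδ (Metric.ball x ρ')
  have hgb : ∀ y, ‖gradient f y‖ ≤ 1 / (ρ - ρ') := fun y => by
    have := norm_gradient_le_of_lipschitzWith hfL y
    rwa [NNReal.coe_inv, Real.coe_toNNReal _ hδ.le, ← one_div] at this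
  have hgout : ∀ y, y ∉ Metric.ball x ρ → gradient f y = 0 := fun y hy => by
    -- `f ≥ 0` attains its minimum at `y`, so the derivative vanishes even on the boundary sphere.
    have hmin : IsLocalMin f y := Filter.Eventually.of_forall fun z => by
      rw [hfout y hy]
      exact hf0 z
    rw [gradient, hmin.fderiv_eq_zero, map_zero]
  have hfp : MemLp f (ENNReal.ofReal p) (volume.restrict Ω) :=
    MemLp.of_bound hfL.continuous.aestronglyMeasurable 1
      (Filter.Eventually.of_forall fun y => by rw [Real.norm_of_nonneg (hf0 y)]; exact hf1 y)
  have hgp : MemLp (gradient f) (ENNReal.ofReal p) (volume.restrict Ω) :=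
    MemLp.of_bound (measurable_gradient f).aestronglyMeasurable (1 / (ρ - ρ'))
      (Filter.Eventually.of_forall hgb)
  have hw : IsWeakGradient Ω (hfp.toLp f) (gradient f) :=
    (hfL.isWeakGradient_gradient Ω).congr_left hfp.coeFn_toLp.symm
  let u : SobolevSpace p Ω := ⟨hfp.toLp f, gradient f, hgp, hw⟩
  -- `weakGrad u` is a chosen weak gradient; by uniqueness it is `gradient f` almost everywhere.
  have hgrad : weakGrad u =ᵐ[volume.restrict Ω] gradient f :=
    IsWeakGradient.ae_eq hΩ Filter.EventuallyEq.rfl (isWeakGradient_weakGrad u) hw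
  refine ⟨u, ?_, ?_⟩
  · filter_upwards [hfp.coeFn_toLp] with y hy hyb
    exact hy.trans (hfin y hyb)
  · rw [ofReal_sobolevNorm hp0]
    have hle : ∫⁻ y in Ω, (‖u.1 y‖ₑ ^ p + ‖weakGrad u y‖ₑ ^ p) ≤
        ENNReal.ofReal (1 + 1 / (ρ - ρ')) ^ p * volume (Metric.ball x ρ ∩ Ω) := by
      calc ∫⁻ y in Ω, (‖u.1 y‖ₑ ^ p + ‖weakGrad u y‖ₑ ^ p)
          ≤ ∫⁻ y in Ω, (Metric.ball x ρ).indicator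
              (fun _ => ENNReal.ofReal (1 + 1 / (ρ - ρ')) ^ p) y := by
            refine lintegral_mono_ae ?_
            filter_upwards [hfp.coeFn_toLp, hgrad] with y hy hgy
            have hy' : u.1 y = f y := hy
            rw [hy', hgy]
            by_cases hyb : y ∈ Metric.ball x ρ
            · rw [indicator_of_mem hyb]
              refine (ENNReal.add_rpow_le_rpow_add _ _ hp).trans
                (ENNReal.rpow_le_rpow ?_ hp0.le)
              rw [← ofReal_norm, ← ofReal_norm, ← ENNReal.ofReal_add (norm_nonneg _)
                (norm_nonneg _), Real.norm_of_nonneg (hf0 y)]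
              exact ENNReal.ofReal_le_ofReal (add_le_add (hf1 y) (hgb y))
            · simp [hfout y hyb, hgout y hyb, hp0]
        _ = _ := by
            rw [lintegral_indicator measurableSet_ball, setLIntegral_const,
              Measure.restrict_apply measurableSet_ball]
    refine (ENNReal.rpow_le_rpow hle (by positivity)).trans (le_of_eq ?_)
    rw [ENNReal.mul_rpow_of_nonneg _ _ (by positivity), ← ENNReal.rpow_mul,
      mul_one_div_cancel hp0.ne', ENNReal.rpow_one]

/-! ### Measure density of extension domains -/

/-- Testing the extension operator with cutoffs between concentric balls compares the volumes of
`Ω` in these balls. The constant does not depend on the center. -/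
theorem IsBoundedExtensionDomain.exists_rpow_volume_ball_inter_le {n : ℕ} {p q q' t : ℝ}
    (hp : 1 ≤ p) (hq' : 1 ≤ q') (hq'n : q' < n) (hqq : q' ≤ q) (ht : 0 < t)
    (hpq : 1 / q' - 1 / n ≤ 1 / t) {Ω : Set (EuclideanSpace ℝ (Fin n))}
    (h : IsBoundedExtensionDomain p q Ω) :
    ∃ C : ℝ, 0 < C ∧ ∀ x ρ' ρ, 0 < ρ' → ρ' < ρ → ρ ≤ Metric.diam Ω →
      volume.real (Metric.ball x ρ' ∩ Ω) ^ (1 / t) ≤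
        C / (ρ - ρ') * volume.real (Metric.ball x ρ ∩ Ω) ^ (1 / p) := by
  have hq0 : 0 < q := by linarith
  obtain ⟨E, C₁, hC₁, hE⟩ := h.exists_extension
  obtain ⟨R, hR, hΩR⟩ : ∃ R : ℝ, 0 < R ∧ Ω ⊆ Metric.ball 0 R := by
    obtain ⟨R, hR⟩ := h.isBounded.subset_ball 0
    exact ⟨max R 1, by positivity, hR.trans (Metric.ball_subset_ball (le_max_left _ _))⟩
  obtain ⟨C₂, hC₂⟩ := exists_eLpNorm_restrict_ball_le hq' hq'n hqq ht hpq hR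
  have hd : 0 ≤ Metric.diam Ω := Metric.diam_nonneg
  refine ⟨(C₂ + 1) * (2 * C₁) * (Metric.diam Ω + 1), by positivity,
    fun x ρ' ρ hρ' hρ hρd => ?_⟩
  have hδ : 0 < ρ - ρ' := by linarith
  have hfin : ∀ r, volume (Metric.ball x r ∩ Ω) ≠ ⊤ := fun r =>
    ((measure_mono inter_subset_left).trans_lt measure_ball_lt_top).ne
  obtain ⟨u, hu1, hun⟩ := exists_sobolevSpace_eq_one_on_ball hp h.isOpen h.isBounded x hρ' hρ
  obtain ⟨hEu, hEn⟩ := hE u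
  have huniv : ∀ {F : Type} [NormedAddCommGroup F] (v : EuclideanSpace ℝ (Fin n) → F),
      eLpNorm v (ENNReal.ofReal q) volume =
        eLpNorm v (ENNReal.ofReal q) (volume.restrict univ) := fun v => by
    rw [Measure.restrict_univ]
  have hsob : eLpNorm (E u).1 (ENNReal.ofReal t) (volume.restrict (Metric.ball 0 R)) ≤
      C₂ * (2 * ENNReal.ofReal (sobolevNorm (E u))) := by
    refine (hC₂ _ _ (isWeakGradient_weakGrad (E u))).trans (mul_le_mul_right ?_ _)
    rw [two_mul]
    refine add_le_add ?_ ?_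
    · exact (huniv _).le.trans (eLpNorm_le_sobolevNorm hq0 (E u))
    · exact (huniv _).le.trans (eLpNorm_weakGrad_le_sobolevNorm hq0 (E u))
  have hlow : volume (Metric.ball x ρ' ∩ Ω) ^ (1 / t) ≤
      eLpNorm (E u).1 (ENNReal.ofReal t) (volume.restrict (Metric.ball 0 R)) := by
    have hA : MeasurableSet (Metric.ball x ρ' ∩ Ω) :=
      measurableSet_ball.inter h.isOpen.measurableSet
    have h1 : (E u).1 =ᵐ[volume.restrict (Metric.ball x ρ' ∩ Ω)] fun _ => (1 : ℝ) := by
      have hΩA : volume.restrict (Metric.ball x ρ' ∩ Ω) ≤ volume.restrict Ω :=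
        Measure.restrict_mono inter_subset_right le_rfl
      filter_upwards [ae_mono hΩA hEu, ae_mono hΩA hu1, ae_restrict_mem hA] with y hy hy1 hyA
      rw [hy, hy1 hyA.1]
    calc volume (Metric.ball x ρ' ∩ Ω) ^ (1 / t)
        = eLpNorm (E u).1 (ENNReal.ofReal t) (volume.restrict (Metric.ball x ρ' ∩ Ω)) := by
          rw [eLpNorm_congr_ae h1, eLpNorm_const' _ (by simpa using ht) ENNReal.ofReal_ne_top,
            ENNReal.toReal_ofReal ht.le, Measure.restrict_apply_univ]
          simp
      _ ≤ _ := eLpNorm_mono_measure _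
          (Measure.restrict_mono (inter_subset_right.trans hΩR) le_rfl)
  have hK : 1 + 1 / (ρ - ρ') ≤ (Metric.diam Ω + 1) / (ρ - ρ') := by
    rw [add_div]
    gcongr
    rw [le_div_iff₀ hδ]
    linarith
  have hfinal : volume (Metric.ball x ρ' ∩ Ω) ^ (1 / t) ≤
      ENNReal.ofReal ((C₂ + 1) * (2 * C₁) * (Metric.diam Ω + 1) / (ρ - ρ')) *
        volume (Metric.ball x ρ ∩ Ω) ^ (1 / p) := by
    refine (hlow.trans hsob).trans ?_
    calc C₂ * (2 * ENNReal.ofReal (sobolevNorm (E u)))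
        ≤ ENNReal.ofReal (C₂ + 1) * (2 * (ENNReal.ofReal C₁ *
            (ENNReal.ofReal ((Metric.diam Ω + 1) / (ρ - ρ')) *
              volume (Metric.ball x ρ ∩ Ω) ^ (1 / p)))) := by
          gcongr
          · rw [← ENNReal.ofReal_coe_nnreal]
            exact ENNReal.ofReal_le_ofReal (by linarith)
          · refine (ENNReal.ofReal_le_ofReal hEn).trans ?_
            rw [ENNReal.ofReal_mul hC₁.le]
            gcongr
            refine hun.trans ?_
            gcongr
      _ = _ := by
          rw [mul_div_assoc, ENNReal.ofReal_mul (by positivity), ENNReal.ofReal_mul (by positivity),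
            ENNReal.ofReal_mul (by positivity : (0 : ℝ) ≤ 2), ENNReal.ofReal_ofNat]
          ring
  have hres := ENNReal.toReal_mono (ENNReal.mul_ne_top ENNReal.ofReal_ne_top
    (ENNReal.rpow_ne_top_of_nonneg (by positivity) (hfin ρ))) hfinal
  rwa [ENNReal.toReal_mul, ENNReal.toReal_ofReal (by positivity), ← ENNReal.toReal_rpow,
    ← ENNReal.toReal_rpow] at hres

/-- The measure density condition, for any exponent `t > p` up to the Sobolev conjugate of some
`q' ≤ q` with `q' < n`. -/
theorem IsBoundedExtensionDomain.exists_le_volume_ball_inter {n : ℕ} {p q q' t s : ℝ}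
    (hp : 1 ≤ p) (hq' : 1 ≤ q') (hq'n : q' < n) (hqq : q' ≤ q) (ht : 0 < t) (hs : 0 < s)
    (hpq : 1 / q' - 1 / n ≤ 1 / t) (hst : 1 / p - 1 / t = 1 / s)
    {Ω : Set (EuclideanSpace ℝ (Fin n))} (h : IsBoundedExtensionDomain p q Ω) :
    ∃ δ : ℝ, 0 < δ ∧ ∀ x ∈ frontier Ω, ∀ r : ℝ, 0 < r → r ≤ Metric.diam Ω / 6 →
      ENNReal.ofReal (δ * r ^ s) ≤ volume (Metric.ball x r ∩ Ω) := by
  obtain ⟨C, hC, hvol⟩ := h.exists_rpow_volume_ball_inter_le hp hq' hq'n hqq ht hpq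
  obtain ⟨δ, hδ, hiter⟩ := exists_rpow_le_of_iterative_bound (by linarith : 0 < p) ht hs hst hC
  refine ⟨δ, hδ, fun x hx r hr hrd => ?_⟩
  have hd : 0 ≤ Metric.diam Ω := Metric.diam_nonneg
  have hfin : ∀ r, volume (Metric.ball x r ∩ Ω) ≠ ⊤ := fun r =>
    ((measure_mono inter_subset_left).trans_lt measure_ball_lt_top).ne
  rw [ENNReal.ofReal_le_iff_le_toReal (hfin r)]
  refine hiter (fun ρ => volume.real (Metric.ball x ρ ∩ Ω)) r hr (fun a b hab => ?_)
    (fun ρ hρ => ?_) fun ρ' ρ h1 h2 h3 => hvol x ρ' ρ h1 h2 (by linarith)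
  · exact measureReal_mono (inter_subset_inter_left _ (Metric.ball_subset_ball hab)) (hfin b)
  · refine ENNReal.toReal_pos ?_ (hfin ρ)
    refine ((Metric.isOpen_ball.inter h.isOpen).measure_pos volume ?_).ne'
    exact mem_closure_iff.1 (frontier_subset_closure hx) _ Metric.isOpen_ball
      (Metric.mem_ball_self hρ)

theorem lemma3p1 (n : ℕ) (hn : 2 ≤ n) (p q : ℝ) (hq : 1 ≤ q) (hqp : q < p)
    (hpq : (p : EReal) < sobolevConjugate n q) :
    ∃ s : ℝ, (n : ℝ) ≤ s ∧
      (q < n → s = 1 / (1 / p - 1 / (sobolevConjugate n q).toReal)) ∧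
      ∀ Ω : Set (EuclideanSpace ℝ (Fin n)), IsBoundedExtensionDomain p q Ω →
        ∃ δ : ℝ, 0 < δ ∧ ∀ x ∈ frontier Ω, ∀ r : ℝ, 0 < r → r ≤ Metric.diam Ω / 6 →
          ENNReal.ofReal (δ * r ^ s) ≤ volume (Metric.ball x r ∩ Ω) := by
  have hn2 : (2 : ℝ) ≤ n := by exact_mod_cast hn
  have hp : 1 ≤ p := by linarith
  rcases lt_or_ge q n with hqn | hqn
  · have hconj : sobolevConjugate n q = ((q * n / (n - q) : ℝ) : EReal) := if_pos hqn
    rw [hconj, EReal.coe_lt_coe_iff] at hpq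
    have hnq : 0 < (n : ℝ) - q := by linarith
    have hinv : 1 / (q * n / (n - q)) = 1 / q - 1 / (n : ℝ) := by
      have : (n : ℝ) - q ≠ 0 := hnq.ne'
      field_simp
    set t := q * n / (n - q)
    have ht0 : 0 < t := by positivity
    have hpos : 0 < 1 / p - 1 / t := sub_pos.2 (one_div_lt_one_div_of_lt (by linarith) hpq)
    refine ⟨1 / (1 / p - 1 / t), ?_, fun _ => by rw [hconj, EReal.toReal_coe], fun Ω h =>
      h.exists_le_volume_ball_inter hp hq hqn le_rfl ht0 (by positivity) hinv.ge
        (by rw [one_div_one_div])⟩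
    rw [le_one_div (by linarith) hpos, hinv]
    have := one_div_lt_one_div_of_lt (by linarith) hqp
    linarith
  · -- `q' = (1/n + 1/(2p))⁻¹` is the exponent whose Sobolev conjugate is `2p`.
    have hd : 0 < 1 / (n : ℝ) + 1 / (2 * p) := by positivity
    refine ⟨2 * p, by linarith, fun h => absurd h (not_lt.2 hqn), fun Ω h =>
      h.exists_le_volume_ball_inter (q' := 1 / (1 / n + 1 / (2 * p))) (t := 2 * p) hp ?_ ?_ ?_
        (by linarith) (by linarith) ?_ ?_⟩
    · rw [le_one_div one_pos hd, one_div_one]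
      have h1 : 1 / (n : ℝ) ≤ 1 / 2 := one_div_le_one_div_of_le two_pos hn2
      have h2 : 1 / (2 * p) ≤ 1 / 2 := one_div_le_one_div_of_le two_pos (by linarith)
      linarith
    · rw [one_div_lt hd (by linarith)]
      have : 0 < 1 / (2 * p) := by positivity
      linarith
    · refine le_trans ?_ hqn
      rw [one_div_le hd (by linarith)]
      have : 0 < 1 / (2 * p) := by positivity
      linarith
    · rw [one_div_one_div, add_sub_cancel_left]
    · field_simp
      norm_num
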